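/- A Banach $^*$-algebra $\mathcal B$ (not necessarily unital) is called symmetric if for every $b\in\mathcal B$ the spectrum of $b^*b$ (computed in the unitization if $\mathcal B$ has no unit) is contained in $[0,\infty)$. Let $\mathsf G$ be a discrete group with unit $\mathsf e$. A twisted $C^*$-dynamical system $(\mathcal A,\alpha,\omega)$ with group $\mathsf G$ consists of a $C^*$-algebra $\mathcal A$ (not necessarily unital), a map $\alpha:\mathsf G\to\mathrm{Aut}(\mathcal A)$ into the $^*$-automorphisms of $\mathcal A$ and a map $\omega:\mathsf G\times\mathsf G\to\mathcal{UM}(\mathcal A)$ into the unitary group of the multiplier algebra such that, for all $x,y,z\in\mathsf G$ (each $\alpha_x$ being extended canonically to the multiplier algebra), $$\alpha_x\circ\alpha_y=\mathrm{ad}_{\omega(x,y)}\circ\alpha_{xy},\qquad \omega(x,y)\,\omega(xy,z)=\alpha_x[\omega(y,z)]\,\omega(x,yz),\qquad \omega(x,\mathsf e)=1=\omega(\mathsf e,x).$$ The $\ell^1$-twisted crossed product $\ell^1_{\alpha,\omega}(\mathsf G;\mathcal A)$ is the Banach space of all $f:\mathsf G\to\mathcal A$ with $\|f\|=\sum_{x}\|f(x)\|<\infty$,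 made into a Banach $^*$-algebra by $$(f\diamond g)(x)=\sum_{y\in\mathsf G}f(y)\,\alpha_y[g(y^{-1}x)]\,\omega(y,y^{-1}x),\qquad f^{\diamond}(x)=\omega(x,x^{-1})^*\,\alpha_x[f(x^{-1})]^* .$$ For $\alpha_x=\mathrm{id}$ and $\omega=1$ it is denoted by $\ell^1(\mathsf G;\mathcal A)$. The group $\mathsf G$ is called rigidly symmetric if $\ell^1(\mathsf G;\mathcal A)$ is symmetric for every $C^*$-algebra $\mathcal A$, and TCP-rigidly symmetric if $\ell^1_{\alpha,\omega}(\mathsf G;\mathcal A)$ is symmetric for every twisted $C^*$-dynamical system $(\mathcal A,\alpha,\omega)$ with group $\mathsf G$. **Statement.** Let $\mathsf G$ be a discrete group and $\mathsf N$ a normal subgroup of $\mathsf G$. If $\mathsf G$ is rigidly symmetric, then $\mathsf G/\mathsf N$ is TCP-rigidly symmetric. Likewise, if $\mathsf G$ is TCP-rigidly symmetric, then $\mathsf G/\mathsf N$ is TCP-rigidly symmetric. -/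

import Mathlib

open scoped MultiplierAlgebra

universe u v

noncomputable section

namespace TwistedCrossedProduct

section Multiplier

variable {A : Type v} [NonUnitalCStarAlgebra A]

/-- A `*`-automorphism of a C*-algebra is isometric. -/
theorem norm_aut (e : A ≃⋆ₐ[ℂ] A) (a : A) : ‖e a‖ = ‖a‖ :=
  NonUnitalStarAlgHom.norm_map e e.injective a

/-- A `*`-automorphism of a C*-algebra as a continuous linear map. -/
def autCLM (e : A ≃⋆ₐ[ℂ] A) : A →L[ℂ] A :=
  LinearMap.mkContinuous
    { toFun := e
      map_add' := map_add e
      map_smul' := map_smul e } 1 (fun a => by simp [norm_aut])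

@[simp] theorem autCLM_apply (e : A ≃⋆ₐ[ℂ] A) (a : A) : autCLM e a = e a := rfl

/-- The canonical extension of a `*`-automorphism `e` of `A` to the multiplier algebra of `A`,
determined by `e(m) e(a) = e(m a)` and `e(a) e(m) = e(a m)`. -/
def extendAut (e : A ≃⋆ₐ[ℂ] A) (m : 𝓜(ℂ, A)) : 𝓜(ℂ, A) where
  fst := autCLM e ∘L m.fst ∘L autCLM e.symm
  snd := autCLM e ∘L m.snd ∘L autCLM e.symm
  central x y := by
    have h := congrArg e (m.central (e.symm x) (e.symm y))
    simpa using h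

@[simp] theorem extendAut_fst (e : A ≃⋆ₐ[ℂ] A) (m : 𝓜(ℂ, A)) (a : A) :
    (extendAut e m).fst a = e (m.fst (e.symm a)) := rfl

@[simp] theorem extendAut_snd (e : A ≃⋆ₐ[ℂ] A) (m : 𝓜(ℂ, A)) (a : A) :
    (extendAut e m).snd a = e (m.snd (e.symm a)) := rfl

theorem mult_ext {m n : 𝓜(ℂ, A)} (h₁ : ∀ a, m.fst a = n.fst a) (h₂ : ∀ a, m.snd a = n.snd a) :
    m = n :=
  DoubleCentralizer.ext ℂ A _ _
    (Prod.ext (ContinuousLinearMap.ext h₁) (ContinuousLinearMap.ext h₂))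

theorem extendAut_refl (m : 𝓜(ℂ, A)) : extendAut (StarAlgEquiv.refl ℂ A) m = m :=
  mult_ext (fun _ => rfl) (fun _ => rfl)

theorem extendAut_mul (e : A ≃⋆ₐ[ℂ] A) (m n : 𝓜(ℂ, A)) :
    extendAut e (m * n) = extendAut e m * extendAut e n :=
  mult_ext (fun a => by simp) (fun a => by simp)

theorem extendAut_star (e : A ≃⋆ₐ[ℂ] A) (m : 𝓜(ℂ, A)) :
    extendAut e (star m) = star (extendAut e m) :=
  mult_ext (fun a => by simp [map_star]) (fun a => by simp [map_star])

/-- The canonical embedding of `A` in its multiplier algebra. -/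
def toMult : A →⋆ₙₐ[ℂ] 𝓜(ℂ, A) := DoubleCentralizer.coeHom

theorem toMult_fst (a b : A) : (toMult a).fst b = a * b := rfl

theorem toMult_snd (a b : A) : (toMult a).snd b = b * a := rfl

theorem toMult_injective : Function.Injective (toMult (A := A)) := by
  rw [injective_iff_map_eq_zero]
  intro a ha
  have h : a * star a = 0 := by
    rw [← toMult_fst, ha]; rfl
  exact CStarRing.mul_star_self_eq_zero_iff a |>.1 h

theorem extendAut_toMult (e : A ≃⋆ₐ[ℂ] A) (a : A) : extendAut e (toMult a) = toMult (e a) :=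
  mult_ext (fun b => by simp [toMult_fst]) (fun b => by simp [toMult_snd])

theorem eq_of_mul_left {a b : A} (h : ∀ c, c * a = c * b) : a = b := by
  have h' : star (a - b) * (a - b) = 0 := by rw [mul_sub, h, sub_self]
  exact sub_eq_zero.1 (CStarRing.star_mul_self_eq_zero_iff _ |>.1 h')

theorem eq_of_mul_right {a b : A} (h : ∀ c, a * c = b * c) : a = b := by
  have h' : (a - b) * star (a - b) = 0 := by rw [sub_mul, h, sub_self]
  exact sub_eq_zero.1 (CStarRing.mul_star_self_eq_zero_iff _ |>.1 h')

theorem toMult_fst_apply (m : 𝓜(ℂ, A)) (a : A) : toMult (m.fst a) = m * toMult a := by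
  refine mult_ext (fun b => eq_of_mul_left fun d => ?_) (fun b => ?_)
  · change d * (m.fst a * b) = d * m.fst (a * b)
    rw [← m.central, ← mul_assoc, ← m.central, mul_assoc]
  · simp [toMult_snd, m.central]

theorem toMult_snd_apply (m : 𝓜(ℂ, A)) (a : A) : toMult (m.snd a) = toMult a * m := by
  refine mult_ext (fun b => ?_) (fun b => eq_of_mul_right fun d => ?_)
  · simp [toMult_fst, m.central]
  · change b * m.snd a * d = m.snd (b * a) * d
    rw [m.central, mul_assoc, m.central, mul_assoc]

theorem norm_snd_unitary (u : unitary 𝓜(ℂ, A)) (a : A) : ‖(u : 𝓜(ℂ, A)).snd a‖ ≤ ‖a‖ := by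
  have h := (u : 𝓜(ℂ, A)).snd.le_opNorm a
  rw [DoubleCentralizer.norm_snd] at h
  have h1 : ‖(u : 𝓜(ℂ, A))‖ ≤ 1 := by
    rcases subsingleton_or_nontrivial 𝓜(ℂ, A) with _ | _
    · simp [Subsingleton.elim (u : 𝓜(ℂ, A)) 0]
    · exact (CStarRing.norm_of_mem_unitary u.2).le
  nlinarith [norm_nonneg a]

end Multiplier

/-- A Banach `*`-algebra (not necessarily unital) is symmetric if the spectrum of `b* b` consists
of nonnegative real numbers for every `b`. The quasispectrum is the spectrum in the unitization;
for a unital algebra it is the usual spectrum together with the point `0`. -/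
def IsSymmetric (B : Type*) [NonUnitalNormedRing B] [StarRing B] [NormedSpace ℂ B]
    [IsScalarTower ℂ B B] [SMulCommClass ℂ B B] [StarModule ℂ B] [NormedStarGroup B]
    [CompleteSpace B] : Prop :=
  ∀ b : B, ∀ z ∈ quasispectrum ℂ (star b * b), 0 ≤ z.re ∧ z.im = 0

/-- A twisted C*-dynamical system `(A, α, ω)` with (discrete) group `G`. -/
structure TwistedSystem (G : Type u) [Group G] (A : Type v) [NonUnitalCStarAlgebra A] where
  /-- the twisted action, by `*`-automorphisms -/
  α : G → (A ≃⋆ₐ[ℂ] A)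
  /-- the 2-cocycle, with values in the unitary multipliers -/
  ω : G → G → unitary 𝓜(ℂ, A)
  /-- `α_x ∘ α_y = ad_{ω(x,y)} ∘ α_{xy}` -/
  α_comp : ∀ (x y : G) (a : A),
    toMult (α x (α y a)) =
      (ω x y : 𝓜(ℂ, A)) * toMult (α (x * y) a) * star (ω x y : 𝓜(ℂ, A))
  /-- `ω(x,y) ω(xy,z) = α_x[ω(y,z)] ω(x,yz)` -/
  cocycle : ∀ x y z : G,
    (ω x y : 𝓜(ℂ, A)) * ω (x * y) z = extendAut (α x) (ω y z) * ω x (y * z)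
  /-- `ω(x,e) = 1` -/
  ω_one_right : ∀ x : G, (ω x 1 : 𝓜(ℂ, A)) = 1
  /-- `ω(e,x) = 1` -/
  ω_one_left : ∀ x : G, (ω 1 x : 𝓜(ℂ, A)) = 1

namespace TwistedSystem

variable {G : Type u} [Group G] {A : Type v} [NonUnitalCStarAlgebra A]

/-- The trivial system: `α_x = id` and `ω = 1`. -/
def trivial (G : Type u) [Group G] (A : Type v) [NonUnitalCStarAlgebra A] : TwistedSystem G A where
  α _ := StarAlgEquiv.refl ℂ A
  ω _ _ := 1
  α_comp _ _ _ := by simp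
  cocycle _ _ _ := by simp [extendAut_refl]
  ω_one_right _ := rfl
  ω_one_left _ := rfl

variable (S : TwistedSystem G A)

/-- The general term `f(y) α_y[g(y⁻¹x)] ω(y, y⁻¹x)` of the twisted convolution. -/
def convTerm (f g : G → A) (x y : G) : A :=
  (S.ω y (y⁻¹ * x) : 𝓜(ℂ, A)).snd (f y * S.α y (g (y⁻¹ * x)))

/-- The twisted convolution `(f ⋄ g)(x) = ∑_y f(y) α_y[g(y⁻¹x)] ω(y, y⁻¹x)`. -/
def conv (f g : G → A) (x : G) : A := ∑' y, S.convTerm f g x y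

/-- The twisted involution `f^⋄(x) = ω(x,x⁻¹)* α_x[f(x⁻¹)]*`. -/
def invol (f : G → A) (x : G) : A :=
  (star (S.ω x x⁻¹ : 𝓜(ℂ, A))).fst (star (S.α x (f x⁻¹)))

theorem norm_convTerm_le (f g : G → A) (x y : G) :
    ‖S.convTerm f g x y‖ ≤ ‖f y‖ * ‖g (y⁻¹ * x)‖ :=
  (norm_snd_unitary _ _).trans ((norm_mul_le _ _).trans_eq (by rw [norm_aut]))

theorem toMult_convTerm (f g : G → A) (x y : G) :
    toMult (S.convTerm f g x y) =
      toMult (f y) * toMult (S.α y (g (y⁻¹ * x))) * (S.ω y (y⁻¹ * x) : 𝓜(ℂ, A)) := by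
  rw [convTerm, toMult_snd_apply, map_mul]

theorem toMult_invol (f : G → A) (x : G) :
    toMult (S.invol f x) =
      star (S.ω x x⁻¹ : 𝓜(ℂ, A)) * star (toMult (S.α x (f x⁻¹))) := by
  rw [invol, toMult_fst_apply, map_star]

theorem α_one (a : A) : S.α 1 a = a := by
  refine (S.α 1).injective (toMult_injective ?_)
  change toMult (S.α 1 (S.α 1 a)) = toMult (S.α 1 a)
  rw [S.α_comp]
  simp [S.ω_one_left]

theorem α_comp' (x y : G) (a : A) :
    (S.ω x y : 𝓜(ℂ, A)) * toMult (S.α (x * y) a) = toMult (S.α x (S.α y a)) * S.ω x y := by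
  rw [S.α_comp, mul_assoc _ (star _) _, Unitary.coe_star_mul_self, mul_one]

theorem invol_invol (f : G → A) : S.invol (S.invol f) = f := by
  funext x
  apply toMult_injective
  have h1 := S.cocycle x x⁻¹ x
  simp only [mul_inv_cancel, inv_mul_cancel, S.ω_one_left, S.ω_one_right, mul_one] at h1
  rw [toMult_invol, ← extendAut_toMult, toMult_invol, extendAut_mul, extendAut_star,
    extendAut_star, extendAut_toMult, inv_inv, S.α_comp x x⁻¹, ← h1, mul_inv_cancel, S.α_one]
  simp only [star_mul, star_star]
  set w : 𝓜(ℂ, A) := (S.ω x x⁻¹ : 𝓜(ℂ, A))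
  have hw : star w * w = 1 := Unitary.coe_star_mul_self _
  calc star w * ((w * (toMult (f x) * star w)) * w)
      = (star w * w) * toMult (f x) * (star w * w) := by noncomm_ring
    _ = _ := by rw [hw]; simp

theorem norm_invol (f : G → A) (x : G) : ‖S.invol f x‖ = ‖f x⁻¹‖ := by
  have key : ∀ (h : G → A) (z : G), ‖S.invol h z‖ ≤ ‖h z⁻¹‖ := by
    intro h z
    have := norm_snd_unitary (S.ω z z⁻¹) (S.α z (h z⁻¹))
    rw [norm_aut] at this
    rwa [invol, DoubleCentralizer.star_fst, star_star, norm_star]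
  refine le_antisymm (key f x) ?_
  have := key (S.invol f) x⁻¹
  rwa [S.invol_invol, inv_inv] at this

/-- The twisted convolution terms of `(f ⋄ g) ⋄ h` and of `f ⋄ (g ⋄ h)` agree. -/
theorem convTerm_assoc (f g h : G → A) (x y w : G) :
    (S.ω (y * w) ((y * w)⁻¹ * x) : 𝓜(ℂ, A)).snd
      (S.convTerm f g (y * w) y * S.α (y * w) (h ((y * w)⁻¹ * x))) =
    (S.ω y (y⁻¹ * x) : 𝓜(ℂ, A)).snd (f y * S.α y (S.convTerm g h (y⁻¹ * x) w)) := by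
  apply toMult_injective
  obtain ⟨v, rfl⟩ : ∃ v, x = y * w * v := ⟨(y * w)⁻¹ * x, by group⟩
  have e1 : (y * w)⁻¹ * (y * w * v) = v := by group
  have e2 : y⁻¹ * (y * w * v) = w * v := by group
  have e3 : y⁻¹ * (y * w) = w := by group
  have e4 : w⁻¹ * (w * v) = v := by group
  rw [toMult_snd_apply, toMult_snd_apply, map_mul, map_mul, toMult_convTerm, ← extendAut_toMult
    (S.α y) (S.convTerm g h _ _), toMult_convTerm, e1, e2, e3, e4, extendAut_mul, extendAut_mul,
    extendAut_toMult, extendAut_toMult]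
  have h1 := S.α_comp' y w (h v)
  have h2 := S.cocycle y w v
  simp only [mul_assoc] at h1 h2 ⊢
  rw [← h2, ← mul_assoc (S.ω y w : 𝓜(ℂ, A)), h1, mul_assoc]

/-- The terms of `g^⋄ ⋄ f^⋄` and of `(f ⋄ g)^⋄` agree. -/
theorem convTerm_invol (f g : G → A) (x y : G) :
    S.convTerm (S.invol g) (S.invol f) x y =
      (star (S.ω x x⁻¹ : 𝓜(ℂ, A))).fst (star (S.α x (S.convTerm f g x⁻¹ (x⁻¹ * y)))) := by
  apply toMult_injective
  obtain ⟨u, rfl⟩ : ∃ u, y = x * u := ⟨x⁻¹ * y, by group⟩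
  have e1 : (x * u)⁻¹ * x = u⁻¹ := by group
  have e2 : x⁻¹ * (x * u) = u := by group
  have e3 : u⁻¹ * x⁻¹ = (x * u)⁻¹ := by group
  rw [toMult_convTerm, toMult_fst_apply, e1, e2, toMult_invol, map_star toMult,
    ← extendAut_toMult _ (S.invol f _), ← extendAut_toMult _ (S.convTerm f g _ _),
    toMult_invol, toMult_convTerm, e3]
  simp only [extendAut_mul, extendAut_star, extendAut_toMult, inv_inv, star_mul]
  have h1 := S.α_comp (x * u) u⁻¹ (f u)
  have h2 := S.α_comp x u (g (x * u)⁻¹)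
  have h3 := S.cocycle (x * u) u⁻¹ u
  have h4 := S.cocycle x u (x * u)⁻¹
  simp only [mul_inv_cancel_right, inv_mul_cancel, S.ω_one_right, mul_one] at h1 h3
  rw [show u * (x * u)⁻¹ = x⁻¹ by group] at h4
  rw [h1, h2, ← h3]
  set a : 𝓜(ℂ, A) := (S.ω (x * u) u⁻¹ : 𝓜(ℂ, A))
  set b : 𝓜(ℂ, A) := (S.ω x u : 𝓜(ℂ, A))
  set c : 𝓜(ℂ, A) := (S.ω (x * u) (x * u)⁻¹ : 𝓜(ℂ, A))
  set d : 𝓜(ℂ, A) := (S.ω x x⁻¹ : 𝓜(ℂ, A))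
  set F := toMult (S.α x (f u))
  set H := toMult (S.α (x * u) (g (x * u)⁻¹))
  have ha : star a * a = 1 := Unitary.coe_star_mul_self _
  have hb : star b * b = 1 := Unitary.coe_star_mul_self _
  have h5 := congrArg star h4
  simp only [star_mul, star_star] at h5 ⊢
  calc star c * star H * (star b * star a * (a * (star F * star a))) * a
      = star c * star H * star b * (star a * a) * star F * (star a * a) := by noncomm_ring
    _ = star c * star H * star b * star F := by rw [ha]; simp
    _ = star c * (star b * b) * star H * star b * star F := by rw [hb]; simp
    _ = (star c * star b) * (b * star H * star b * star F) := by noncomm_ring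
    _ = _ := by rw [h5]; noncomm_ring

/-- The `ℓ¹` twisted crossed product `ℓ¹_{α,ω}(G; A)`: the Banach space of absolutely summable
functions from `G` to `A`; its product and involution are the twisted ones given below. -/
def L1 (_S : TwistedSystem G A) : Type (max u v) := lp (fun _ : G => A) 1

namespace L1

variable {S}

instance : NormedAddCommGroup S.L1 := inferInstanceAs (NormedAddCommGroup (lp (fun _ : G => A) 1))

instance : NormedSpace ℂ S.L1 := inferInstanceAs (NormedSpace ℂ (lp (fun _ : G => A) 1))

instance : CompleteSpace S.L1 := inferInstanceAs (CompleteSpace (lp (fun _ : G => A) 1))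

/-- The underlying function of an element of the `ℓ¹` twisted crossed product. -/
def toFun (f : S.L1) : G → A := (show lp (fun _ : G => A) 1 from f).1

instance : CoeFun S.L1 (fun _ => G → A) := ⟨toFun⟩

theorem ext {f g : S.L1} (h : ∀ x, f x = g x) : f = g := Subtype.ext (funext h)

theorem add_apply (f g : S.L1) (x : G) : (f + g) x = f x + g x := rfl

theorem zero_apply (x : G) : (0 : S.L1) x = 0 := rfl

theorem smul_apply (c : ℂ) (f : S.L1) (x : G) : (c • f) x = c • f x := rfl

theorem summable_norm (f : S.L1) : Summable fun x => ‖f x‖ := by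
  have h := (lp.memℓp (show lp (fun _ : G => A) 1 from f)).summable (by simp)
  simp only [ENNReal.toReal_one, Real.rpow_one] at h
  exact h

theorem norm_eq (f : S.L1) : ‖f‖ = ∑' x, ‖f x‖ := by
  have h := lp.norm_eq_tsum_rpow (p := 1) (by simp) (show lp (fun _ : G => A) 1 from f)
  simp only [ENNReal.toReal_one, Real.rpow_one, div_one] at h
  exact h

/-- An absolutely summable function as an element of the `ℓ¹` twisted crossed product. -/
def mk (f : G → A) (hf : Summable fun x => ‖f x‖) : S.L1 :=
  (⟨f, memℓp_gen (by simpa using hf)⟩ : lp (fun _ : G => A) 1)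

theorem mk_apply (f : G → A) (hf : Summable fun x => ‖f x‖) (x : G) : (mk f hf : S.L1) x = f x :=
  rfl

/-- The change of variables `(x, y) ↦ (y, y⁻¹x)`. -/
def shear : G × G ≃ G × G where
  toFun p := (p.2, p.2⁻¹ * p.1)
  invFun p := (p.1 * p.2, p.1)
  left_inv p := by simp
  right_inv p := by simp

theorem summable_prod (f g : S.L1) :
    Summable fun p : G × G => ‖f p.2‖ * ‖g (p.2⁻¹ * p.1)‖ :=
  (shear (G := G)).summable_iff.2
    (f.summable_norm.mul_of_nonneg g.summable_norm (fun _ => norm_nonneg _)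
      (fun _ => norm_nonneg _))

theorem summable_norm_convTerm (f g : S.L1) (x : G) : Summable fun y => ‖S.convTerm f g x y‖ :=
  .of_nonneg_of_le (fun _ => norm_nonneg _) (fun y => S.norm_convTerm_le f g x y)
    ((summable_prod f g).prod_factor x)

theorem summable_convTerm (f g : S.L1) (x : G) : Summable fun y => S.convTerm f g x y :=
  (summable_norm_convTerm f g x).of_norm

theorem norm_conv_le (f g : S.L1) (x : G) :
    ‖S.conv f g x‖ ≤ ∑' y, ‖f y‖ * ‖g (y⁻¹ * x)‖ :=
  (norm_tsum_le_tsum_norm (summable_norm_convTerm f g x)).trans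
    ((summable_norm_convTerm f g x).tsum_le_tsum (fun y => S.norm_convTerm_le f g x y)
      ((summable_prod f g).prod_factor x))

theorem summable_norm_conv (f g : S.L1) : Summable fun x => ‖S.conv f g x‖ :=
  .of_nonneg_of_le (fun _ => norm_nonneg _) (norm_conv_le f g) (summable_prod f g).prod

theorem tsum_prod (f g : S.L1) :
    ∑' x, ∑' y, ‖f y‖ * ‖g (y⁻¹ * x)‖ = (∑' x, ‖f x‖) * ∑' x, ‖g x‖ := by
  rw [← (summable_prod f g).tsum_prod, f.summable_norm.tsum_mul_tsum g.summable_norm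
    (f.summable_norm.mul_of_nonneg g.summable_norm (fun _ => norm_nonneg _)
      (fun _ => norm_nonneg _))]
  exact (shear (G := G)).tsum_eq fun p : G × G => ‖f p.1‖ * ‖g p.2‖

instance : Mul S.L1 := ⟨fun f g => mk (S.conv f g) (summable_norm_conv f g)⟩

theorem mul_apply (f g : S.L1) (x : G) : (f * g) x = ∑' y, S.convTerm f g x y := rfl

theorem summable_norm_invol (f : S.L1) : Summable fun x => ‖S.invol f x‖ := by
  simp only [S.norm_invol]
  exact (Equiv.inv G).summable_iff.2 f.summable_norm

instance : Star S.L1 := ⟨fun f => mk (S.invol f) (summable_norm_invol f)⟩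

theorem star_apply (f : S.L1) (x : G) : star f x = S.invol f x := rfl

theorem norm_mul_le' (f g : S.L1) : ‖f * g‖ ≤ ‖f‖ * ‖g‖ := by
  rw [norm_eq, norm_eq, norm_eq, ← tsum_prod]
  exact (summable_norm_conv f g).tsum_le_tsum (norm_conv_le f g) (summable_prod f g).prod

theorem norm_star' (f : S.L1) : ‖star f‖ = ‖f‖ := by
  rw [norm_eq, norm_eq, ← (Equiv.inv G).tsum_eq fun x => ‖f x‖]
  exact tsum_congr fun x => S.norm_invol f x

theorem summable_triple (f g h : S.L1) (x : G) :
    Summable fun p : G × G => ‖f p.1‖ * (‖g p.2‖ * ‖h (p.2⁻¹ * (p.1⁻¹ * x))‖) := by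
  have hb : ∀ y, ‖h y‖ ≤ ‖h‖ := fun y => by
    rw [norm_eq]; exact h.summable_norm.le_tsum y (fun _ _ => norm_nonneg _)
  refine .of_nonneg_of_le (fun _ => by positivity) (fun p => ?_)
    ((f.summable_norm.mul_of_nonneg g.summable_norm (fun _ => norm_nonneg _)
      (fun _ => norm_nonneg _)).mul_right ‖h‖)
  rw [← mul_assoc]
  gcongr
  exact hb _

theorem mul_assoc' (f g h : S.L1) : f * g * h = f * (g * h) := by
  refine ext fun x => ?_
  have hF : Summable fun p : G × G =>
      (S.ω p.1 (p.1⁻¹ * x) : 𝓜(ℂ, A)).snd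
        (f p.1 * S.α p.1 (S.convTerm g h (p.1⁻¹ * x) p.2)) := by
    refine Summable.of_norm (.of_nonneg_of_le (fun _ => norm_nonneg _) (fun p => ?_)
      (summable_triple f g h x))
    refine (norm_snd_unitary _ _).trans ((norm_mul_le _ _).trans ?_)
    rw [norm_aut]
    gcongr
    exact S.norm_convTerm_le g h _ _
  have hr : (f * (g * h)) x = ∑' y, ∑' w, (S.ω y (y⁻¹ * x) : 𝓜(ℂ, A)).snd
      (f y * S.α y (S.convTerm g h (y⁻¹ * x) w)) := by
    rw [mul_apply]
    refine tsum_congr fun y => ?_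
    let T : A →L[ℂ] A := (S.ω y (y⁻¹ * x) : 𝓜(ℂ, A)).snd ∘L
      ContinuousLinearMap.mul ℂ A (f y) ∘L autCLM (S.α y)
    exact T.map_tsum (summable_convTerm g h (y⁻¹ * x))
  let e : G × G ≃ G × G := shear
  have hF' := e.summable_iff.2 hF
  rw [hr, ← hF.tsum_prod, ← e.tsum_eq, Summable.tsum_prod (by exact hF'), mul_apply]
  refine tsum_congr fun z => ?_
  let T : A →L[ℂ] A := (S.ω z (z⁻¹ * x) : 𝓜(ℂ, A)).snd ∘L
    (ContinuousLinearMap.mul ℂ A).flip (S.α z (h (z⁻¹ * x)))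
  refine (T.map_tsum (summable_convTerm f g z)).trans (tsum_congr fun y => ?_)
  have := S.convTerm_assoc f g h x y (y⁻¹ * z)
  rw [mul_inv_cancel_left] at this
  exact this

theorem star_mul' (f g : S.L1) : star (f * g) = star g * star f := by
  refine ext fun x => ?_
  rw [mul_apply, star_apply]
  let T : A →L[ℂ] A := (star (star (S.ω x x⁻¹ : 𝓜(ℂ, A)))).snd ∘L autCLM (S.α x)
  have h1 : S.invol (f * g : S.L1) x = star (T (∑' y, S.convTerm f g x⁻¹ y)) := by
    simp only [TwistedSystem.invol, DoubleCentralizer.star_fst, star_star, T]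
    rfl
  rw [h1, T.map_tsum (summable_convTerm f g x⁻¹), tsum_star,
    ← (Equiv.mulLeft x⁻¹).tsum_eq]
  refine tsum_congr fun y => ?_
  refine Eq.trans ?_ (S.convTerm_invol f g x y).symm
  simp [T]

theorem left_distrib' (f g h : S.L1) : f * (g + h) = f * g + f * h := by
  refine ext fun x => ?_
  rw [add_apply, mul_apply, mul_apply, mul_apply,
    ← (summable_convTerm f g x).tsum_add (summable_convTerm f h x)]
  exact tsum_congr fun y => by simp [convTerm, add_apply, mul_add]

theorem right_distrib' (f g h : S.L1) : (f + g) * h = f * h + g * h := by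
  refine ext fun x => ?_
  rw [add_apply, mul_apply, mul_apply, mul_apply,
    ← (summable_convTerm f h x).tsum_add (summable_convTerm g h x)]
  exact tsum_congr fun y => by simp [convTerm, add_apply, add_mul]

theorem smul_mul' (c : ℂ) (f g : S.L1) : c • f * g = c • (f * g) := by
  refine ext fun x => ?_
  rw [smul_apply, mul_apply, mul_apply, ← (summable_convTerm f g x).tsum_const_smul]
  exact tsum_congr fun y => by simp [convTerm, smul_apply, smul_mul_assoc]

theorem mul_smul' (c : ℂ) (f g : S.L1) : f * c • g = c • (f * g) := by
  refine ext fun x => ?_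
  rw [smul_apply, mul_apply, mul_apply, ← (summable_convTerm f g x).tsum_const_smul]
  exact tsum_congr fun y => by simp [convTerm, smul_apply, mul_smul_comm]

theorem star_add' (f g : S.L1) : star (f + g) = star f + star g := by
  refine ext fun x => ?_
  rw [add_apply, star_apply, star_apply, star_apply]
  simp only [invol, add_apply, map_add, star_add]

theorem star_smul' (c : ℂ) (f : S.L1) : star (c • f) = star c • star f := by
  refine ext fun x => ?_
  rw [smul_apply, star_apply, star_apply]
  simp only [invol, smul_apply, map_smul, star_smul]

instance : NonUnitalNormedRing S.L1 where
  __ := (inferInstance : NormedAddCommGroup S.L1)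
  mul := (· * ·)
  mul_assoc := mul_assoc'
  left_distrib := left_distrib'
  right_distrib := right_distrib'
  zero_mul f := by simpa using smul_mul' (0 : ℂ) f f
  mul_zero f := by simpa using mul_smul' (0 : ℂ) f f
  norm_mul_le := norm_mul_le'

instance : StarRing S.L1 where
  star_involutive f := ext fun x => congrFun (S.invol_invol f) x
  star_mul := star_mul'
  star_add := star_add'

instance : IsScalarTower ℂ S.L1 S.L1 := ⟨smul_mul'⟩

instance : SMulCommClass ℂ S.L1 S.L1 := ⟨fun c f g => (mul_smul' c f g).symm⟩

instance : StarModule ℂ S.L1 := ⟨star_smul'⟩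

instance : NormedStarGroup S.L1 := ⟨fun f => (norm_star' f).le⟩

end L1

end TwistedSystem

/-- The discrete group `G` is rigidly symmetric: the Banach `*`-algebra `ℓ¹(G; A)`, which is the
twisted crossed product of the trivial system, is symmetric for every C*-algebra `A`. -/
def IsRigidlySymmetric (G : Type u) [Group G] : Prop :=
  ∀ (A : Type v) [NonUnitalCStarAlgebra A], IsSymmetric (TwistedSystem.trivial G A).L1

/-- The discrete group `G` is TCP-rigidly symmetric: the Banach `*`-algebra `ℓ¹_{α,ω}(G; A)` is
symmetric for every twisted C*-dynamical system `(A, α, ω)` with group `G`. -/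
def IsTCPRigidlySymmetric (G : Type u) [Group G] : Prop :=
  ∀ (A : Type v) [NonUnitalCStarAlgebra A] (S : TwistedSystem G A), IsSymmetric S.L1

end TwistedCrossedProduct

end

/-!
Symmetry passes from a Banach `*`-algebra to its images, because a homomorphism shrinks
quasispectra, and to its closed `*`-subalgebras, because the frontier of a spectrum does not grow
when the algebra shrinks and `ℂ ∖ [0, ∞)` is connected and unbounded.

Represent `A` faithfully on a Hilbert space `E`. In the regular representation on `ℓ²(G, E)` the
element `a` at `x` acts by translation by `x` weighted by the operators `α_q⁻¹(a ω(x, x⁻¹q))`. This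
is isometric on each fibre, so sending `f` to the operator-valued function `x ↦ (f(x) at x)` embeds
`ℓ¹_{α,ω}(G; A)` isometrically in the untwisted algebra `ℓ¹(G; B(ℓ²(G, E)))`, and rigid symmetry
gives TCP-rigid symmetry. For a surjection `G → H`, a twisted system over `H` pulls back to `G`, and
summation over the fibres maps the crossed product over `G` onto the one over `H`.
-/

noncomputable section

namespace TwistedCrossedProduct

section Symmetric

theorem subset_of_frontier_subset {X : Type*} [TopologicalSpace X] [Bornology X] {s t : Set X}
    (hs : Bornology.IsBounded s) (ht : IsPreconnected tᶜ) (ht' : ¬Bornology.IsBounded tᶜ)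
    (hst : frontier s ⊆ t) : s ⊆ t := by
  by_contra h
  obtain ⟨z, hz, hzt⟩ := Set.not_subset.1 h
  have hcover : tᶜ ⊆ interior s ∪ (closure s)ᶜ := fun w hw => by
    by_contra hw'
    rw [Set.mem_union, not_or, Set.notMem_compl_iff] at hw'
    exact hw (hst ⟨hw'.2, hw'.1⟩)
  have hz' : z ∈ interior s :=
    (hcover hzt).resolve_right fun hz' => hz' (subset_closure hz)
  have hsub : tᶜ ⊆ interior s :=
    ht.subset_left_of_subset_union isOpen_interior isClosed_closure.isOpen_compl
      (Set.disjoint_compl_right_iff_subset.2 interior_subset_closure) hcover ⟨z, hzt, hz'⟩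
  exact ht' (hs.subset (hsub.trans interior_subset))

theorem compl_nonneg_eq_neg_slitPlane :
    {z : ℂ | 0 ≤ z.re ∧ z.im = 0}ᶜ = -Complex.slitPlane := by
  ext z
  simp only [Set.mem_compl_iff, Set.mem_ofPred_eq, Set.mem_neg, Complex.mem_slitPlane_iff,
    Complex.neg_re, Complex.neg_im, neg_pos, ne_eq, neg_eq_zero, not_and_or, not_le]

theorem isPreconnected_compl_nonneg : IsPreconnected {z : ℂ | 0 ≤ z.re ∧ z.im = 0}ᶜ := by
  rw [compl_nonneg_eq_neg_slitPlane, ← Set.image_neg_eq_neg]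
  exact (Complex.starConvex_one_slitPlane.isPathConnected
    Complex.one_mem_slitPlane).isConnected.isPreconnected.image _ continuous_neg.continuousOn

theorem not_isBounded_compl_nonneg : ¬Bornology.IsBounded {z : ℂ | 0 ≤ z.re ∧ z.im = 0}ᶜ := by
  intro h
  obtain ⟨C, hC⟩ := h.exists_norm_le
  have hmem : -((|C| + 1 : ℝ) : ℂ) ∈ {z : ℂ | 0 ≤ z.re ∧ z.im = 0}ᶜ := fun hz => by
    have := hz.1
    rw [Complex.neg_re, Complex.ofReal_re] at this
    linarith [abs_nonneg C]
  have := hC _ hmem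
  rw [norm_neg, Complex.norm_of_nonneg (by positivity)] at this
  linarith [le_abs_self C]

section Spectrum

theorem frontier_spectrum_subset {𝕜 B C : Type*} [NormedField 𝕜]
    [NormedRing B] [NormedAlgebra 𝕜 B] [CompleteSpace B] [NormedRing C] [NormedAlgebra 𝕜 C]
    [CompleteSpace C] (φ : B →ₐ[𝕜] C) (hφ : Isometry φ) (b : B) :
    frontier (spectrum 𝕜 b) ⊆ spectrum 𝕜 (φ b) := by
  have hclosed : IsClosed (φ.range : Set C) := by
    rw [AlgHom.coe_range]
    exact hφ.isClosedEmbedding.isClosed_range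
  rw [← AlgEquiv.spectrum_eq (AlgEquiv.ofInjective φ hφ.injective)]
  exact Subalgebra.frontier_spectrum φ.range (hS := hclosed) _

variable {𝕜 B C : Type*} [NormedField 𝕜]
  [NonUnitalNormedRing B] [NormedSpace 𝕜 B] [IsScalarTower 𝕜 B B] [SMulCommClass 𝕜 B B]
  [NonUnitalNormedRing C] [NormedSpace 𝕜 C] [IsScalarTower 𝕜 C C] [SMulCommClass 𝕜 C C]

/-- The unital extension of an algebra homomorphism to the `ℓ¹`-unitizations. -/
def unitizationMap (φ : B →ₙₐ[𝕜] C) :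
    WithLp 1 (Unitization 𝕜 B) →ₐ[𝕜] WithLp 1 (Unitization 𝕜 C) :=
  ((WithLp.unitizationAlgEquiv 𝕜).symm.toAlgHom.comp
    (Unitization.lift ((Unitization.inrNonUnitalAlgHom 𝕜 C).comp φ))).comp
      (WithLp.unitizationAlgEquiv 𝕜).toAlgHom

theorem unitizationMap_inr (φ : B →ₙₐ[𝕜] C) (b : B) :
    unitizationMap φ (WithLp.toLp 1 (b : Unitization 𝕜 B)) =
      WithLp.toLp 1 (φ b : Unitization 𝕜 C) :=
  congrArg (WithLp.toLp 1) (by simp)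

theorem isometry_unitizationMap {φ : B →ₙₐ[𝕜] C} (hφ : Isometry φ) :
    Isometry (unitizationMap φ) := by
  have hnorm (b : B) : ‖φ b‖ = ‖b‖ := hφ.norm_map_of_map_zero (map_zero φ) b
  refine AddMonoidHomClass.isometry_of_norm _ fun x => ?_
  simp [WithLp.unitization_norm_def, unitizationMap, Unitization.algebraMap_eq_inl, hnorm]

theorem quasispectrum_eq_spectrum_toLp_inr (b : B) :
    quasispectrum 𝕜 b = spectrum 𝕜 (WithLp.toLp 1 (b : Unitization 𝕜 B)) := by
  rw [Unitization.quasispectrum_eq_spectrum_inr]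
  exact (AlgEquiv.spectrum_eq (WithLp.unitizationAlgEquiv (𝕜 := 𝕜) (A := B) 𝕜).symm _).symm

theorem isBounded_quasispectrum [CompleteSpace 𝕜] [CompleteSpace B] (b : B) :
    Bornology.IsBounded (quasispectrum 𝕜 b) := by
  rw [quasispectrum_eq_spectrum_toLp_inr]
  exact spectrum.isBounded _

theorem frontier_quasispectrum_subset [CompleteSpace 𝕜] [CompleteSpace B] [CompleteSpace C]
    (φ : B →ₙₐ[𝕜] C) (hφ : Isometry φ) (b : B) :
    frontier (quasispectrum 𝕜 b) ⊆ quasispectrum 𝕜 (φ b) := by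
  rw [quasispectrum_eq_spectrum_toLp_inr, quasispectrum_eq_spectrum_toLp_inr,
    ← unitizationMap_inr]
  exact frontier_spectrum_subset _ (isometry_unitizationMap hφ) _

end Spectrum

variable {B C : Type*}
  [NonUnitalNormedRing B] [StarRing B] [NormedSpace ℂ B] [IsScalarTower ℂ B B]
  [SMulCommClass ℂ B B] [StarModule ℂ B] [NormedStarGroup B] [CompleteSpace B]
  [NonUnitalNormedRing C] [StarRing C] [NormedSpace ℂ C] [IsScalarTower ℂ C C]
  [SMulCommClass ℂ C C] [StarModule ℂ C] [NormedStarGroup C] [CompleteSpace C]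

theorem IsSymmetric.of_surjective (hB : IsSymmetric B) (φ : B →⋆ₙₐ[ℂ] C)
    (hφ : Function.Surjective φ) : IsSymmetric C := by
  intro c z hz
  obtain ⟨b, rfl⟩ := hφ c
  rw [← map_star, ← map_mul] at hz
  exact hB b z (NonUnitalAlgHom.quasispectrum_apply_subset φ _ hz)

theorem IsSymmetric.of_isometry (hC : IsSymmetric C) (φ : B →⋆ₙₐ[ℂ] C) (hφ : Isometry φ) :
    IsSymmetric B := by
  intro b
  have hfrontier : frontier (quasispectrum ℂ (star b * b)) ⊆ {z | 0 ≤ z.re ∧ z.im = 0} :=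
    fun z hz => hC (φ b) z <| by
      simpa only [map_mul, map_star, NonUnitalStarAlgHom.coe_toNonUnitalAlgHom] using
        frontier_quasispectrum_subset φ.toNonUnitalAlgHom hφ _ hz
  exact subset_of_frontier_subset (isBounded_quasispectrum _) isPreconnected_compl_nonneg
    not_isBounded_compl_nonneg hfrontier

end Symmetric

section WeightedComposition

open scoped NNReal ENNReal InnerProductSpace

variable {ι κ : Type*} {E : ι → Type*} {F : κ → Type*} [∀ i, NormedAddCommGroup (E i)]
  [∀ k, NormedAddCommGroup (F k)] {p : ℝ≥0∞} {e : κ → ι}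

theorem memℓp_comp_of_injective (he : Function.Injective e) {ξ : ∀ i, E i} (hξ : Memℓp ξ p) :
    Memℓp (fun k => ξ (e k)) p := by
  rcases p.trichotomy with rfl | rfl | hp
  · exact memℓp_zero (hξ.finite_dsupport.preimage he.injOn)
  · exact memℓp_infty (hξ.bddAbove.mono (Set.range_comp_subset_range e fun i => ‖ξ i‖))
  · exact memℓp_gen ((hξ.summable hp).comp_injective he)

theorem norm_comp_le_of_injective (hp : p ≠ 0) (he : Function.Injective e) (ξ : lp E p) :
    ‖(⟨fun k => ξ (e k), memℓp_comp_of_injective he (lp.memℓp ξ)⟩ : lp (fun k => E (e k)) p)‖ ≤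
      ‖ξ‖ := by
  rcases p.trichotomy with rfl | rfl | hp'
  · exact absurd rfl hp
  · exact lp.norm_le_of_forall_le (lp.norm_nonneg' ξ) fun k => lp.norm_apply_le_norm hp ξ (e k)
  · refine lp.norm_le_of_tsum_le hp' (lp.norm_nonneg' ξ) ?_
    rw [lp.norm_rpow_eq_tsum hp']
    exact tsum_comp_le_tsum_of_inj ((lp.memℓp ξ).summable hp') (fun _ => by positivity) he

variable {𝕜 : Type*} [RCLike 𝕜] [∀ i, NormedSpace 𝕜 (E i)] [∀ k, NormedSpace 𝕜 (F k)]
  {C : ℝ≥0}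

theorem norm_apply_le_norm_smul (T : ∀ k, E (e k) →L[𝕜] F k) (hT : ∀ k, ‖T k‖ ≤ C)
    (ξ : ∀ i, E i) (k : κ) : ‖T k (ξ (e k))‖ ≤ ‖((C : ℝ) : 𝕜) • ξ (e k)‖ := by
  rw [norm_smul, RCLike.norm_ofReal, NNReal.abs_eq]
  exact (T k).le_of_opNorm_le (hT k) _

variable (he : Function.Injective e) (T : ∀ k, E (e k) →L[𝕜] F k) (hT : ∀ k, ‖T k‖ ≤ C)

/-- The weighted composition operator `(ξ i)_i ↦ (T k (ξ (e k)))_k` between `ℓᵖ`-direct sums,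
for an injective change of indices `e` and a uniformly bounded family of weights `T`. -/
def weightedCompLinearMap (p : ℝ≥0∞) : lp E p →ₗ[𝕜] lp F p where
  toFun ξ := ⟨fun k => T k (ξ (e k)),
    ((memℓp_comp_of_injective he (lp.memℓp ξ)).const_smul ((C : ℝ) : 𝕜)).mono'
      (norm_apply_le_norm_smul T hT ξ)⟩
  map_add' _ _ := lp.ext (funext fun k => map_add (T k) _ _)
  map_smul' c _ := lp.ext (funext fun k => map_smul (T k) c _)

theorem norm_weightedCompLinearMap_le (hp : p ≠ 0) (ξ : lp E p) :
    ‖weightedCompLinearMap he T hT p ξ‖ ≤ C * ‖ξ‖ := by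
  let ξe : lp (fun k => E (e k)) p := ⟨_, memℓp_comp_of_injective he (lp.memℓp ξ)⟩
  calc ‖weightedCompLinearMap he T hT p ξ‖
      ≤ ‖((C : ℝ) : 𝕜) • ξe‖ := lp.norm_mono hp (norm_apply_le_norm_smul T hT ξ)
    _ = C * ‖ξe‖ := by rw [lp.norm_const_smul hp, RCLike.norm_ofReal, NNReal.abs_eq]
    _ ≤ C * ‖ξ‖ := by gcongr; exact norm_comp_le_of_injective hp he ξ

/-- The weighted composition operator as a bounded operator. -/
def weightedComp (p : ℝ≥0∞) [hp : Fact (1 ≤ p)] : lp E p →L[𝕜] lp F p :=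
  (weightedCompLinearMap he T hT p).mkContinuous C
    (norm_weightedCompLinearMap_le he T hT (zero_lt_one.trans_le hp.out).ne')

variable [Fact (1 ≤ p)]

theorem weightedComp_apply (ξ : lp E p) (k : κ) : weightedComp he T hT p ξ k = T k (ξ (e k)) :=
  rfl

theorem norm_weightedComp_le : ‖weightedComp he T hT p‖ ≤ C :=
  LinearMap.mkContinuous_norm_le _ C.coe_nonneg _

theorem norm_le_norm_weightedComp (k : κ) : ‖T k‖ ≤ ‖weightedComp he T hT p‖ := by
  classical
  have hp : 0 < p := zero_lt_one.trans_le Fact.out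
  refine ContinuousLinearMap.opNorm_le_bound _ (norm_nonneg _) fun v => ?_
  calc ‖T k v‖ = ‖weightedComp he T hT p (lp.single p (e k) v) k‖ := by
        rw [weightedComp_apply, lp.single_apply_self]
    _ ≤ ‖weightedComp he T hT p (lp.single p (e k) v)‖ := lp.norm_apply_le_norm hp.ne' _ k
    _ ≤ ‖weightedComp he T hT p‖ * ‖v‖ := by
        rw [← lp.norm_single (E := E) hp (e k) v]
        exact ContinuousLinearMap.le_opNorm _ _

end WeightedComposition

section Adjoint

open scoped InnerProductSpace

variable {𝕜 ι κ : Type*} [RCLike 𝕜] {E : ι → Type*} {F : κ → Type*}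
  [∀ i, NormedAddCommGroup (E i)] [∀ i, InnerProductSpace 𝕜 (E i)] [∀ i, CompleteSpace (E i)]
  [∀ k, NormedAddCommGroup (F k)] [∀ k, InnerProductSpace 𝕜 (F k)] [∀ k, CompleteSpace (F k)]

theorem eq_adjoint_of_forall_inner_apply (e : κ ≃ ι) {U : lp E 2 →L[𝕜] lp F 2}
    {V : lp F 2 →L[𝕜] lp E 2}
    (h : ∀ ξ η k, ⟪U ξ k, η k⟫_𝕜 = ⟪ξ (e k), V η (e k)⟫_𝕜) :
    U = ContinuousLinearMap.adjoint V := by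
  refine (ContinuousLinearMap.eq_adjoint_iff U V).2 fun ξ η => ?_
  rw [lp.inner_eq_tsum, lp.inner_eq_tsum, ← e.tsum_eq]
  exact tsum_congr (h ξ η)

end Adjoint

section Representation

open scoped ComplexOrder

section Functional

variable {A : Type*} [NonUnitalCStarAlgebra A] [PartialOrder A] [StarOrderedRing A]

theorem exists_positiveLinearMap_apply_ne_zero {a : A} (ha : 0 ≤ a) (ha' : a ≠ 0) :
    ∃ f : A →ₚ[ℂ] ℂ, f a ≠ 0 := by
  have hmem : -a ∉ ProperCone.positive ℝ A := fun h =>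
    ha' (le_antisymm (neg_nonneg.1 (ProperCone.mem_positive.1 h)) ha)
  obtain ⟨g, hg, hga⟩ := ProperCone.hyperplane_separation_point (ProperCone.positive ℝ A) hmem
  let F : A →ₗ[ℂ] ℂ := Module.Dual.extendRCLike
    (g.toLinearMap ∘ₗ (selfAdjoint.submodule ℝ A).subtype ∘ₗ realPart)
  have hF {x : A} (hx : 0 ≤ x) : F x = g x := by
    have hx' : IsSelfAdjoint x := .of_nonneg hx
    have hI : realPart (Complex.I • x) = 0 := by
      rw [realPart_I_smul, hx'.imaginaryPart, neg_zero]
    change (g (realPart x : A) : ℂ) - Complex.I * g (realPart (Complex.I • x) : A) = g x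
    simp [hI, hx'.coe_realPart]
  refine ⟨PositiveLinearMap.mk₀ F fun x hx => ?_, fun h => ?_⟩
  · rw [hF hx]
    exact Complex.zero_le_real.2 (hg x hx)
  · rw [map_neg, neg_neg_iff_pos] at hga
    have : F a = 0 := h
    rw [hF ha] at this
    exact hga.ne' (Complex.ofReal_eq_zero.1 this)

theorem exists_gnsNonUnitalStarAlgHom_ne_zero {a : A} (ha : a ≠ 0) :
    ∃ f : A →ₚ[ℂ] ℂ, f.gnsNonUnitalStarAlgHom a ≠ 0 := by
  have hb : star (a * star a) * (a * star a) ≠ 0 := by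
    simpa only [ne_eq, CStarRing.star_mul_self_eq_zero_iff, CStarRing.mul_star_self_eq_zero_iff]
      using ha
  obtain ⟨f, hf⟩ := exists_positiveLinearMap_apply_ne_zero (star_mul_self_nonneg _) hb
  refine ⟨f, fun h => hf ?_⟩
  have h0 := congrArg norm (congrArg (· (f.toPreGNS (star a) : f.GNS)) h)
  simp only [PositiveLinearMap.gnsNonUnitalStarAlgHom_apply_coe, UniformSpace.Completion.norm_coe,
    zero_apply, norm_zero] at h0
  have h1 := f.preGNS_norm_sq (f.leftMulMapPreGNS a (f.toPreGNS (star a)))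
  rw [h0] at h1
  simpa using h1.symm

end Functional

section DirectSum

variable {A ι : Type*} [NonUnitalCStarAlgebra A] {E : ι → Type*} [∀ i, NormedAddCommGroup (E i)]
  [∀ i, InnerProductSpace ℂ (E i)] [∀ i, CompleteSpace (E i)]

/-- The Hilbert space direct sum of a family of representations. -/
def directSumRep (π : ∀ i, A →⋆ₙₐ[ℂ] (E i →L[ℂ] E i)) : A →⋆ₙₐ[ℂ] (lp E 2 →L[ℂ] lp E 2) where
  toFun a := weightedComp (C := ‖a‖₊) Function.injective_id (fun i => π i a)
    (fun i => NonUnitalStarAlgHom.norm_apply_le (π i) a) 2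
  map_smul' c a := by
    ext ξ i
    exact congrArg (· (ξ i)) (map_smul (π i) c a)
  map_zero' := by
    ext ξ i
    exact congrArg (· (ξ i)) (map_zero (π i))
  map_add' a b := by
    ext ξ i
    exact congrArg (· (ξ i)) (map_add (π i) a b)
  map_mul' a b := by
    ext ξ i
    exact congrArg (· (ξ i)) (map_mul (π i) a b)
  map_star' a := eq_adjoint_of_forall_inner_apply (.refl ι) fun ξ η i => by
    change inner ℂ (π i (star a) (ξ i)) (η i) = inner ℂ (ξ i) (π i a (η i))
    rw [map_star, ContinuousLinearMap.star_eq_adjoint, ContinuousLinearMap.adjoint_inner_left]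

theorem norm_apply_le_norm_directSumRep (π : ∀ i, A →⋆ₙₐ[ℂ] (E i →L[ℂ] E i)) (i : ι) (a : A) :
    ‖π i a‖ ≤ ‖directSumRep π a‖ :=
  norm_le_norm_weightedComp Function.injective_id (fun i => π i a) _ i

end DirectSum

theorem exists_injective_representation (A : Type v) [NonUnitalCStarAlgebra A] :
    ∃ (H : Type v) (_ : NormedAddCommGroup H) (_ : InnerProductSpace ℂ H) (_ : CompleteSpace H)
      (π : A →⋆ₙₐ[ℂ] (H →L[ℂ] H)), Function.Injective π := by
  let _ := CStarAlgebra.spectralOrder A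
  have := CStarAlgebra.spectralOrderedRing A
  let π := directSumRep fun f : A →ₚ[ℂ] ℂ => f.gnsNonUnitalStarAlgHom
  refine ⟨_, inferInstance, inferInstance, inferInstance, π,
    (injective_iff_map_eq_zero π).2 fun a ha => ?_⟩
  by_contra h0
  obtain ⟨f, hf⟩ := exists_gnsNonUnitalStarAlgHom_ne_zero h0
  have h := norm_apply_le_norm_directSumRep (fun f : A →ₚ[ℂ] ℂ => f.gnsNonUnitalStarAlgHom) f a
  rw [show directSumRep _ a = 0 from ha, norm_zero] at h
  exact hf (norm_le_zero_iff.1 h)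

end Representation

namespace TwistedSystem

section Fibre

variable {G A : Type*} [Group G] [NonUnitalCStarAlgebra A] (S : TwistedSystem G A)

/-- The product `a α_x(b) ω(x, y)` of an element `a` of the fibre over `x` and an element `b` of the
fibre over `y` in the Fell bundle of a twisted system; every fibre is a copy of `A`. -/
def fiberMul (x y : G) : A →L[ℂ] A →L[ℂ] A :=
  (ContinuousLinearMap.compL ℂ A A A (S.ω x y : 𝓜(ℂ, A)).snd ∘L
    ContinuousLinearMap.mul ℂ A).bilinearComp (.id ℂ A) (autCLM (S.α x))

/-- The involution `a ↦ ω(x, x⁻¹)* α_x(a)*` from the fibre over `x⁻¹` to the fibre over `x` in the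
Fell bundle of a twisted system. -/
def fiberStar (x : G) : A →L⋆[ℂ] A :=
  (star (S.ω x x⁻¹ : 𝓜(ℂ, A))).fst ∘SL (starL ℂ : A ≃L⋆[ℂ] A).toContinuousLinearMap ∘SL
    autCLM (S.α x)

theorem fiberMul_apply (x y : G) (a b : A) :
    S.fiberMul x y a b = (S.ω x y : 𝓜(ℂ, A)).snd (a * S.α x b) := rfl

theorem fiberStar_apply (x : G) (a : A) :
    S.fiberStar x a = (star (S.ω x x⁻¹ : 𝓜(ℂ, A))).fst (star (S.α x a)) := rfl

theorem L1.mul_apply_eq_tsum_fiberMul (f g : S.L1) (x : G) :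
    (f * g) x = ∑' y, S.fiberMul y (y⁻¹ * x) (f y) (g (y⁻¹ * x)) := rfl

theorem L1.summable_fiberMul (f g : S.L1) (x : G) :
    Summable fun y => S.fiberMul y (y⁻¹ * x) (f y) (g (y⁻¹ * x)) :=
  L1.summable_convTerm f g x

theorem L1.star_apply_eq_fiberStar (f : S.L1) (x : G) : star f x = S.fiberStar x (f x⁻¹) := rfl

end Fibre

section Hom

variable {G A B : Type*} [Group G] [NonUnitalCStarAlgebra A] [NonUnitalCStarAlgebra B]

/-- A morphism of the Fell bundles of two twisted systems over the same group. -/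
structure Hom (S : TwistedSystem G A) (T : TwistedSystem G B) where
  /-- the map between the fibres over `x` -/
  fiber (x : G) : A →L[ℂ] B
  norm_fiber_le (x : G) (a : A) : ‖fiber x a‖ ≤ ‖a‖
  fiber_mul (x y : G) (a b : A) :
    fiber (x * y) (S.fiberMul x y a b) = T.fiberMul x y (fiber x a) (fiber y b)
  fiber_star (x : G) (a : A) : fiber x (S.fiberStar x a) = T.fiberStar x (fiber x⁻¹ a)

namespace L1

variable {S : TwistedSystem G A} {T : TwistedSystem G B} (ρ : S.Hom T)

/-- The `*`-homomorphism between `ℓ¹` twisted crossed products induced by a morphism of Fell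
bundles. -/
def map : S.L1 →⋆ₙₐ[ℂ] T.L1 where
  toFun f := mk (fun x => ρ.fiber x (f x))
    (f.summable_norm.of_nonneg_of_le (fun _ => norm_nonneg _) fun x => ρ.norm_fiber_le x (f x))
  map_smul' _ _ := ext fun x => map_smul (ρ.fiber x) _ _
  map_zero' := ext fun x => map_zero (ρ.fiber x)
  map_add' _ _ := ext fun x => map_add (ρ.fiber x) _ _
  map_mul' f g := ext fun x => by
    rw [mul_apply_eq_tsum_fiberMul, mk_apply, mul_apply_eq_tsum_fiberMul,
      (ρ.fiber x).map_tsum (summable_fiberMul S f g x)]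
    refine tsum_congr fun y => ?_
    have h := ρ.fiber_mul y (y⁻¹ * x) (f y) (g (y⁻¹ * x))
    rwa [mul_inv_cancel_left] at h
  map_star' f := ext fun x => ρ.fiber_star x (f x⁻¹)

theorem map_apply (f : S.L1) (x : G) : map ρ f x = ρ.fiber x (f x) := rfl

theorem isometry_map (hρ : ∀ x a, ‖ρ.fiber x a‖ = ‖a‖) : Isometry (map ρ) := by
  refine AddMonoidHomClass.isometry_of_norm _ fun f => ?_
  simp only [norm_eq, map_apply, hρ]

end L1

end Hom

section Trivial

variable {G A : Type*} [Group G] [NonUnitalCStarAlgebra A]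

theorem trivial_fiberStar (x : G) (a : A) : (trivial G A).fiberStar x a = star a := by
  rw [fiberStar_apply, DoubleCentralizer.star_fst, star_star]
  rfl

end Trivial

section RegularRepresentation

variable {G A : Type*} [Group G] [NonUnitalCStarAlgebra A] (S : TwistedSystem G A)

theorem toMult_α_mul_α_symm (x r : G) (a : A) :
    toMult (S.α (x * r) ((S.α r).symm a)) =
      star (S.ω x r : 𝓜(ℂ, A)) * toMult (S.α x a) * S.ω x r := by
  have h := S.α_comp' x r ((S.α r).symm a)
  rw [StarAlgEquiv.apply_symm_apply] at h
  rw [mul_assoc, ← h, ← mul_assoc, Unitary.coe_star_mul_self, one_mul]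

/-- The coefficient `α_q⁻¹(a ω(x, x⁻¹q))` by which an element `a` of the fibre over `x` acts in the
regular representation, from position `x⁻¹q` to position `q`. -/
def coeff (x q : G) : A →L[ℂ] A := autCLM (S.α q).symm ∘L (S.ω x (x⁻¹ * q) : 𝓜(ℂ, A)).snd

theorem coeff_apply (x q : G) (a : A) :
    S.coeff x q a = (S.α q).symm ((S.ω x (x⁻¹ * q) : 𝓜(ℂ, A)).snd a) := rfl

theorem toMult_α_coeff (x q : G) (a : A) :
    toMult (S.α q (S.coeff x q a)) = toMult a * S.ω x (x⁻¹ * q) := by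
  rw [coeff_apply, StarAlgEquiv.apply_symm_apply, toMult_snd_apply]

theorem coeff_mul_coeff (x y q : G) (a b : A) :
    S.coeff x q a * S.coeff y (x⁻¹ * q) b = S.coeff (x * y) q (S.fiberMul x y a b) := by
  refine EquivLike.injective (S.α q) (toMult_injective ?_)
  obtain ⟨s, rfl⟩ : ∃ s, q = x * (y * s) := ⟨(x * y)⁻¹ * q, by group⟩
  have e1 : (x * y)⁻¹ * (x * (y * s)) = s := by group
  rw [map_mul, map_mul, toMult_α_coeff, toMult_α_coeff, fiberMul_apply, toMult_snd_apply, e1,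
    inv_mul_cancel_left, coeff_apply, toMult_α_mul_α_symm, inv_mul_cancel_left,
    ← extendAut_toMult, toMult_snd_apply, extendAut_mul, extendAut_toMult, map_mul]
  have hcocycle := S.cocycle x y s
  set w : 𝓜(ℂ, A) := (S.ω x (y * s) : 𝓜(ℂ, A))
  have hw : w * star w = 1 := Unitary.coe_mul_star_self _
  simp only [mul_assoc] at hcocycle ⊢
  rw [hcocycle, ← mul_assoc w, hw, one_mul]

theorem star_coeff (x q : G) (a : A) :
    star (S.coeff x⁻¹ (x⁻¹ * q) a) = S.coeff x q (S.fiberStar x a) := by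
  refine EquivLike.injective (S.α q) (toMult_injective ?_)
  obtain ⟨r, rfl⟩ : ∃ r, q = x * r := ⟨x⁻¹ * q, by group⟩
  rw [toMult_α_coeff, map_star, map_star toMult, inv_mul_cancel_left, coeff_apply,
    toMult_α_mul_α_symm, inv_inv, ← extendAut_toMult (S.α x), toMult_snd_apply, fiberStar_apply,
    toMult_fst_apply, extendAut_mul, extendAut_toMult, map_star toMult]
  have hcocycle := congrArg star (S.cocycle x x⁻¹ (x * r))
  rw [mul_inv_cancel, S.ω_one_left, mul_one, inv_mul_cancel_left, star_mul] at hcocycle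
  rw [hcocycle]
  simp only [star_mul, star_star, mul_assoc]

theorem norm_coeff_le (x q : G) (a : A) : ‖S.coeff x q a‖ ≤ ‖a‖ := by
  rw [coeff_apply, norm_aut]
  exact norm_snd_unitary _ _

theorem norm_coeff_self (x : G) (a : A) : ‖S.coeff x x a‖ = ‖a‖ := by
  rw [coeff_apply, norm_aut, inv_mul_cancel, S.ω_one_right]
  rfl

variable {E : Type*} [NormedAddCommGroup E] [InnerProductSpace ℂ E] [CompleteSpace E]
  (π : A →⋆ₙₐ[ℂ] (E →L[ℂ] E))

theorem norm_rep_coeff_le (x q : G) (a : A) : ‖π (S.coeff x q a)‖ ≤ ‖a‖ :=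
  (NonUnitalStarAlgHom.norm_apply_le π _).trans (S.norm_coeff_le x q a)

/-- The operator `(U ξ)(q) = π(coeff x q a) ξ(x⁻¹q)` on `ℓ²(G, E)` by which an element `a` of the
fibre over `x` acts in the regular representation induced from `π`. -/
def regularOp (x : G) (a : A) : lp (fun _ : G => E) 2 →L[ℂ] lp (fun _ : G => E) 2 :=
  weightedComp (C := ‖a‖₊) (mul_right_injective x⁻¹) (fun q => π (S.coeff x q a))
    (fun q => S.norm_rep_coeff_le π x q a) 2

theorem regularOp_apply (x : G) (a : A) (ξ : lp (fun _ : G => E) 2) (q : G) :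
    S.regularOp π x a ξ q = π (S.coeff x q a) (ξ (x⁻¹ * q)) := rfl

theorem norm_rep_coeff_le_norm_regularOp (x q : G) (a : A) :
    ‖π (S.coeff x q a)‖ ≤ ‖S.regularOp π x a‖ :=
  norm_le_norm_weightedComp (E := fun _ => E) (C := ‖a‖₊) (mul_right_injective x⁻¹)
    (fun q => π (S.coeff x q a)) _ q

theorem regularOp_mul_regularOp (x y : G) (a b : A) :
    S.regularOp π x a * S.regularOp π y b = S.regularOp π (x * y) (S.fiberMul x y a b) := by
  ext ξ q
  rw [mul_apply_eq_comp, regularOp_apply, regularOp_apply, regularOp_apply,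
    ← coeff_mul_coeff, map_mul, mul_inv_rev, mul_assoc, mul_apply_eq_comp]

theorem star_regularOp (x : G) (a : A) :
    star (S.regularOp π x⁻¹ a) = S.regularOp π x (S.fiberStar x a) := by
  symm
  refine eq_adjoint_of_forall_inner_apply (Equiv.mulLeft x⁻¹) fun ξ η q => ?_
  rw [Equiv.coe_mulLeft, regularOp_apply, regularOp_apply, ← star_coeff, map_star,
    ContinuousLinearMap.star_eq_adjoint, ContinuousLinearMap.adjoint_inner_left, inv_inv,
    mul_inv_cancel_left]

/-- The regular representation induced from `π`, as a morphism from the Fell bundle of a twisted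
system to the trivial one with fibre the bounded operators on `ℓ²(G, E)`. -/
def regularHom : S.Hom (trivial G (lp (fun _ : G => E) 2 →L[ℂ] lp (fun _ : G => E) 2)) where
  fiber x := LinearMap.mkContinuous
    { toFun := S.regularOp π x
      map_add' := fun a b => by
        ext ξ q
        simp [regularOp_apply]
      map_smul' := fun c a => by
        ext ξ q
        simp [regularOp_apply] }
    1 fun a => (norm_weightedComp_le _ _ _).trans_eq (one_mul _).symm
  norm_fiber_le _ _ := norm_weightedComp_le _ _ _
  fiber_mul x y a b := (S.regularOp_mul_regularOp π x y a b).symm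
  fiber_star x a := (S.star_regularOp π x a).symm.trans (trivial_fiberStar x _).symm

theorem norm_regularHom_fiber (hπ : Function.Injective π) (x : G) (a : A) :
    ‖(S.regularHom π).fiber x a‖ = ‖a‖ := by
  refine le_antisymm ((S.regularHom π).norm_fiber_le x a) ?_
  calc ‖a‖ = ‖π (S.coeff x x a)‖ := by
        rw [NonUnitalStarAlgHom.norm_map π hπ, norm_coeff_self]
    _ ≤ ‖S.regularOp π x a‖ := S.norm_rep_coeff_le_norm_regularOp π x x a

end RegularRepresentation

end TwistedSystem

theorem IsRigidlySymmetric.isTCPRigidlySymmetric {G : Type u} [Group G]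
    (h : IsRigidlySymmetric.{u, max u v} G) : IsTCPRigidlySymmetric.{u, max u v} G := by
  intro A _ S
  obtain ⟨H, _, _, _, π, hπ⟩ := exists_injective_representation A
  exact (h _).of_isometry (TwistedSystem.L1.map (S.regularHom π))
    (TwistedSystem.L1.isometry_map _ (S.norm_regularHom_fiber π hπ))

namespace TwistedSystem

section Pushforward

variable {G H A : Type*} [Group G] [Group H] [NonUnitalCStarAlgebra A]

/-- The pullback of a twisted system along a group homomorphism. -/
def comap (φ : G →* H) (T : TwistedSystem H A) : TwistedSystem G A where
  α x := T.α (φ x)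
  ω x y := T.ω (φ x) (φ y)
  α_comp x y a := by rw [map_mul, T.α_comp]
  cocycle x y z := by rw [map_mul, map_mul, T.cocycle]
  ω_one_right x := by rw [map_one, T.ω_one_right]
  ω_one_left x := by rw [map_one, T.ω_one_left]

variable (φ : G →* H) (T : TwistedSystem H A)

theorem comap_fiberMul (x y : G) : (T.comap φ).fiberMul x y = T.fiberMul (φ x) (φ y) := rfl

theorem comap_fiberStar (x : G) : (T.comap φ).fiberStar x = T.fiberStar (φ x) := by
  ext a
  rw [fiberStar_apply, fiberStar_apply, ← map_inv]
  rfl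

namespace L1

theorem summable_norm_tsum_fiber (f : (T.comap φ).L1) :
    Summable fun q => ‖∑' x : φ ⁻¹' {q}, f x‖ :=
  (f.summable_norm.hasSum.tsum_fiberwise φ).summable.of_nonneg_of_le (fun _ => norm_nonneg _)
    fun _ => norm_tsum_le_tsum_norm (f.summable_norm.subtype _)

variable {T}

/-- Summation over the fibres of a group homomorphism, for functions with values in a twisted
system pulled back along it. -/
def fiberSum (f : (T.comap φ).L1) : T.L1 :=
  mk (fun q => ∑' x : φ ⁻¹' {q}, f x) (summable_norm_tsum_fiber φ T f)

theorem fiberSum_apply (f : (T.comap φ).L1) (q : H) :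
    fiberSum φ f q = ∑' x : φ ⁻¹' {q}, f x := rfl

theorem summable_fiber (f : (T.comap φ).L1) (q : H) : Summable fun x : φ ⁻¹' {q} => f x :=
  f.summable_norm.of_norm.subtype _

theorem summable_fiberMul_fiber (f g : (T.comap φ).L1) (q : H) :
    Summable fun p : G × φ ⁻¹' {q} =>
      (T.comap φ).fiberMul p.1 (p.1⁻¹ * p.2) (f p.1) (g (p.1⁻¹ * p.2)) := by
  have hinj : Function.Injective fun p : G × φ ⁻¹' {q} => ((p.2 : G), p.1) :=
    Prod.swap_injective.comp (Function.injective_id.prodMap Subtype.val_injective)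
  exact .of_norm (((summable_prod f g).comp_injective hinj).of_nonneg_of_le
    (fun _ => norm_nonneg _) fun p => (T.comap φ).norm_convTerm_le f g p.2 p.1)

theorem tsum_fiber_fiberMul (g : (T.comap φ).L1) (a : A) (y : G) (q : H) :
    ∑' x : φ ⁻¹' {q}, (T.comap φ).fiberMul y (y⁻¹ * x) a (g (y⁻¹ * x)) =
      T.fiberMul (φ y) ((φ y)⁻¹ * q) a (fiberSum φ g ((φ y)⁻¹ * q)) := by
  let e : φ ⁻¹' {q} ≃ φ ⁻¹' {(φ y)⁻¹ * q} := (Equiv.mulLeft y⁻¹).subtypeEquiv fun x => by simp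
  rw [fiberSum_apply, (T.fiberMul _ _ a).map_tsum (summable_fiber φ g _), ← e.tsum_eq]
  refine tsum_congr fun x => ?_
  have hx : φ x = q := x.2
  rw [comap_fiberMul, map_mul, map_inv, hx]
  rfl

theorem tsum_fiberMul_fiber (f : (T.comap φ).L1) (b : H → A) (p q : H) :
    ∑' y : φ ⁻¹' {p}, T.fiberMul (φ y) ((φ y)⁻¹ * q) (f y) (b (φ y)) =
      T.fiberMul p (p⁻¹ * q) (fiberSum φ f p) (b p) := by
  let M : A →L[ℂ] A := (T.fiberMul p (p⁻¹ * q)).flip (b p)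
  refine Eq.trans (tsum_congr fun y => ?_) (M.map_tsum (summable_fiber φ f p)).symm
  have hy : φ y = p := y.2
  rw [hy]
  rfl

theorem fiberSum_mul (f g : (T.comap φ).L1) :
    fiberSum φ (f * g) = fiberSum φ f * fiberSum φ g := by
  refine ext fun q => ?_
  let F (y : G) (x : φ ⁻¹' {q}) : A :=
    (T.comap φ).fiberMul y (y⁻¹ * x) (f y) (g (y⁻¹ * x))
  have hF : Summable (Function.uncurry F) := summable_fiberMul_fiber φ f g q
  have hsum : Summable fun y =>
      T.fiberMul (φ y) ((φ y)⁻¹ * q) (f y) (fiberSum φ g ((φ y)⁻¹ * q)) :=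
    hF.prod.congr fun y => tsum_fiber_fiberMul φ g (f y) y q
  calc ∑' x, ∑' y, F y x = ∑' y, ∑' x, F y x := hF.tsum_comm
    _ = ∑' y, T.fiberMul (φ y) ((φ y)⁻¹ * q) (f y) (fiberSum φ g ((φ y)⁻¹ * q)) :=
        tsum_congr fun y => tsum_fiber_fiberMul φ g (f y) y q
    _ = ∑' p, ∑' y : φ ⁻¹' {p},
          T.fiberMul (φ y) ((φ y)⁻¹ * q) (f y) (fiberSum φ g ((φ y)⁻¹ * q)) :=
        (hsum.hasSum.tsum_fiberwise φ).tsum_eq.symm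
    _ = ∑' p, T.fiberMul p (p⁻¹ * q) (fiberSum φ f p) (fiberSum φ g (p⁻¹ * q)) :=
        tsum_congr fun p => tsum_fiberMul_fiber φ f (fun p => fiberSum φ g (p⁻¹ * q)) p q

theorem fiberSum_star (f : (T.comap φ).L1) : fiberSum φ (star f) = star (fiberSum φ f) := by
  refine ext fun q => ?_
  let e : φ ⁻¹' {q} ≃ φ ⁻¹' {q⁻¹} := (Equiv.inv G).subtypeEquiv fun x => by simp
  rw [star_apply_eq_fiberStar, fiberSum_apply, fiberSum_apply,
    (T.fiberStar q).map_tsum (summable_fiber φ f _), ← e.tsum_eq]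
  refine tsum_congr fun x => ?_
  have hx : φ x = q := x.2
  rw [star_apply_eq_fiberStar, comap_fiberStar, hx]
  rfl

variable (T) in
/-- The `*`-homomorphism of `ℓ¹` twisted crossed products that sums over the fibres of a group
homomorphism. -/
def pushforward : (T.comap φ).L1 →⋆ₙₐ[ℂ] T.L1 where
  toFun := fiberSum φ
  map_smul' c f := ext fun q => (summable_fiber φ f q).tsum_const_smul c
  map_zero' := ext fun _ => tsum_zero
  map_add' f g := ext fun q => (summable_fiber φ f q).tsum_add (summable_fiber φ g q)
  map_mul' := fiberSum_mul φ
  map_star' := fiberSum_star φ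

variable {φ} in
theorem pushforward_surjective (hφ : Function.Surjective φ) :
    Function.Surjective (pushforward φ T) := by
  intro F
  let s := Function.surjInv hφ
  have hs : Function.Injective s := Function.injective_surjInv hφ
  let f : G → A := Function.extend s F 0
  have hf : Summable fun x => ‖f x‖ := by
    refine (hs.summable_iff fun x hx => ?_).1 ?_
    · simp [f, Function.extend_apply' _ _ _ hx]
    · simpa [f, Function.comp_def, hs.extend_apply] using F.summable_norm
  have hφs (q : H) : φ (s q) = q := Function.surjInv_eq hφ q
  refine ⟨mk f hf, ext fun q => ?_⟩
  change ∑' x : φ ⁻¹' {q}, f x = F q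
  rw [tsum_eq_single ⟨s q, hφs q⟩]
  · exact hs.extend_apply F 0 q
  · rintro ⟨x, hxq⟩ hx
    refine Function.extend_apply' _ _ _ fun ⟨p, hp⟩ => hx (Subtype.ext ?_)
    have hpq : p = q := by rw [← hφs p, hp]; exact hxq
    exact hp.symm.trans (congrArg s hpq)

end L1

end Pushforward

end TwistedSystem

theorem IsTCPRigidlySymmetric.of_surjective {G H : Type u} [Group G] [Group H]
    (h : IsTCPRigidlySymmetric.{u, v} G) (φ : G →* H) (hφ : Function.Surjective φ) :
    IsTCPRigidlySymmetric.{u, v} H := fun A _ T =>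
  (h A (T.comap φ)).of_surjective _ (TwistedSystem.L1.pushforward_surjective hφ)

end TwistedCrossedProduct

end

theorem mainTheorem5 {G : Type u} [Group G] (N : Subgroup G) [N.Normal] :
    (TwistedCrossedProduct.IsRigidlySymmetric.{u, max u v} G →
      TwistedCrossedProduct.IsTCPRigidlySymmetric.{u, max u v} (G ⧸ N)) ∧
    (TwistedCrossedProduct.IsTCPRigidlySymmetric.{u, max u v} G →
      TwistedCrossedProduct.IsTCPRigidlySymmetric.{u, max u v} (G ⧸ N)) := by
  have hN : Function.Surjective (QuotientGroup.mk' N) := QuotientGroup.mk'_surjective N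
  exact ⟨fun h => h.isTCPRigidlySymmetric.of_surjective _ hN, fun h => h.of_surjective _ hN⟩
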